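/- **Proposition 3.5 (String and dilaton equations).** For $g\ge 0$, $n\ge 1$ and positive integers $\beta_1,\dots,\beta_n$ with sum $d$, let $r=2g-1+n$, and let $H^g_{(d),\beta}$ be the one-part double Hurwitz number, that is, $|\operatorname{Aut}\beta|/d!$ times the number of tuples $(\sigma,\tau_1,\dots,\tau_r,\gamma)$ of permutations of $\{1,\dots,d\}$ such that $\sigma$ has cycle type $\beta$, $\gamma$ is a $d$-cycle, the $\tau_i$ are transpositions, $\tau_r\cdots\tau_1\sigma=\gamma$, and $\sigma,\tau_1,\dots,\tau_r$ generate a transitive group. (Here $|\operatorname{Aut}\beta|=\prod_i a_i!$, where $a_i$ is the number of parts of $\beta$ equal to $i$.) For $(g,n)\ne(0,1),(0,2)$ there is a unique polynomial $R_{g,n}\in\mathbb{Q}[\beta_1,\dots,\beta_n]$ such that $H^g_{(d),\beta}=r!\,(\beta_1+\cdots+\beta_n)\,R_{g,n}(\beta_1,\dots,\beta_n)$ for all positive integers $\beta_1,\dots,\beta_n$. For $g,k,n\ge 0$ and integers $b_1,\dots,b_n$ define $$\langle\langle\tau_{b_1}\cdots\tau_{b_n}\Lambda_{2k}\rangle\rangle_g=(-1)^k\,[\beta_1^{b_1}\cdots\beta_n^{b_n}]\,R_{g,n}(\beta_1,\dots,\beta_n)$$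 if $(g,n)\ne(0,1),(0,2)$, all $b_i\ge 0$ and $\sum_i b_i+2k=4g-3+n$ (which forces $n\ge 1$), and $\langle\langle\tau_{b_1}\cdots\tau_{b_n}\Lambda_{2k}\rangle\rangle_g=0$ otherwise. Then the following holds for all integers $g,k,n\ge 0$ and all integers $b_1,\dots,b_n$. (a) (String equation) $$\langle\langle\tau_0\tau_{b_1}\cdots\tau_{b_n}\Lambda_{2k}\rangle\rangle_g=\sum_{i=1}^n\langle\langle\tau_{b_1}\cdots\tau_{b_{i-1}}\tau_{b_i-1}\tau_{b_{i+1}}\cdots\tau_{b_n}\Lambda_{2k}\rangle\rangle_g,$$ except when $g=k=1$, $n=0$, and except when $g=k=0$, $n=2$, $b_1=b_2=0$. In these exceptional cases $\langle\langle\tau_0\Lambda_2\rangle\rangle_1=1/24$ and $\langle\langle\tau_0\tau_0\tau_0\Lambda_0\rangle\rangle_0=1$. (b) (Dilaton equation) $$\langle\langle\tau_1\tau_{b_1}\cdots\tau_{b_n}\Lambda_{2k}\rangle\rangle_g=(2g-2+n)\,\langle\langle\tau_{b_1}\cdots\tau_{b_n}\Lambda_{2k}\rangle\rangle_g.$$ 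-/

import Mathlib

open scoped Nat

/-- `|Aut α| = ∏ i, a_i!`, where `a_i` is the number of parts of the partition `α` equal to `i`. -/
def partitionAut {d : ℕ} (α : Nat.Partition d) : ℕ :=
  ∏ i ∈ α.parts.toFinset, (α.parts.count i)!

/-- The Riemann-Hurwitz number `r = 2g - 2 + m + n` of simple branch points of a genus `g` cover
whose ramification profiles over `0` and `∞` have `m` and `n` parts. (Partitions of a positive
integer have `m, n ≥ 1`, so that the subtraction in `ℕ` does not truncate.) -/
def simpleBranchNumber (g m n : ℕ) : ℕ := 2 * g + m + n - 2

/-- `(σ, τ_1, …, τ_r, γ)` is a transitive ordered factorization of type `(α, β)`: `σ` has cycle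
type `β` and `γ` has cycle type `α` (fixed points count as parts equal to `1`), the `τ_i` are
transpositions, `τ_r ⋯ τ_1 σ = γ`, and `σ, τ_1, …, τ_r` generate a transitive subgroup. -/
def IsTransitiveFactorization {d r : ℕ} (α β : Nat.Partition d)
    (σ : Equiv.Perm (Fin d)) (τ : Fin r → Equiv.Perm (Fin d)) (γ : Equiv.Perm (Fin d)) : Prop :=
  σ.partition.parts = β.parts ∧ γ.partition.parts = α.parts ∧ (∀ i, (τ i).IsSwap) ∧
    (List.ofFn τ).reverse.prod * σ = γ ∧
    MulAction.IsPretransitive (Subgroup.closure ({σ} ∪ Set.range τ)) (Fin d)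

/-- The (connected) double Hurwitz number `H^g_{α,β}`, with labelled points over `0` and `∞`:
`|Aut α| |Aut β| / d!` times the number of transitive ordered factorizations of type `(α, β)` with
`r = 2g - 2 + l(α) + l(β)` transpositions. -/
noncomputable def doubleHurwitz (g : ℕ) {d : ℕ} (α β : Nat.Partition d) : ℚ :=
  (partitionAut α : ℚ) * (partitionAut β : ℚ) / (d ! : ℚ) *
    (Nat.card {x : Equiv.Perm (Fin d) ×
        (Fin (simpleBranchNumber g α.parts.card β.parts.card) → Equiv.Perm (Fin d)) ×
        Equiv.Perm (Fin d) // IsTransitiveFactorization α β x.1 x.2.1 x.2.2} : ℚ)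

/-- The one-part double Hurwitz number `H^g_{(d),β}` as a function of `(β_1, …, β_n)`, where
`d = β_1 + ⋯ + β_n`. (It is only used where all `β_i` are positive.) -/
noncomputable def onePartHurwitz (g : ℕ) {n : ℕ} (β : Fin n → ℕ) : ℚ :=
  doubleHurwitz g (Nat.Partition.indiscrete (∑ i, β i))
    (Nat.Partition.ofSums (∑ i, β i) (Finset.univ.val.map β) rfl)

/-- `P` is the one-part Hurwitz polynomial `P^g_{1,n}(β_1, …, β_n)`: it agrees with `H^g_{(d),β}`
at all `n`-tuples of positive integers. -/
def IsOnePartHurwitzPolynomial (g n : ℕ) (P : MvPolynomial (Fin n) ℚ) : Prop :=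
  ∀ β : Fin n → ℕ, (∀ i, 0 < β i) →
    MvPolynomial.eval (fun i => (β i : ℚ)) P = onePartHurwitz g β

/-- `R` is the quotient `P^g_{1,n}(β_1, …, β_n) / (r! d)`, where `r = 2g - 1 + n` and
`d = β_1 + ⋯ + β_n`. -/
def IsOnePartHurwitzQuotient (g n : ℕ) (R : MvPolynomial (Fin n) ℚ) : Prop :=
  IsOnePartHurwitzPolynomial g n
    (MvPolynomial.C ((simpleBranchNumber g 1 n)! : ℚ) * (∑ i, MvPolynomial.X i) * R)

open Classical in
/-- The polynomial `P^g_{1,n} / (r! d)`. -/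
noncomputable def onePartHurwitzQuotient (g n : ℕ) : MvPolynomial (Fin n) ℚ :=
  if h : ∃ R, IsOnePartHurwitzQuotient g n R then h.choose else 0

open Classical in
/-- The symbol `⟨⟨τ_{b_1} ⋯ τ_{b_n} Λ_{2k}⟩⟩_g`. Indices `b_i` are integers, since `τ_{b_i - 1}`
occurs in the string equation; the symbol vanishes as soon as one of them is negative. -/
noncomputable def hurwitzSymbol (g k : ℕ) {n : ℕ} (b : Fin n → ℤ) : ℚ :=
  if (g, n) ≠ (0, 1) ∧ (g, n) ≠ (0, 2) ∧ ∑ i, b i + 2 * (k : ℤ) = 4 * (g : ℤ) - 3 + (n : ℤ) ∧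
      ∀ i, 0 ≤ b i then
    (-1) ^ k * MvPolynomial.coeff (Finsupp.equivFunOnFinite.symm fun i => (b i).toNat)
      (onePartHurwitzQuotient g n)
  else 0

/-!
The statement rests on the closed formula of Goulden, Jackson and Vakil `H^g_{(d),β} = r! d^{r-1}
[t^{2g}] (∏ i, S(β_i t)) / S(t)`, where `S(t) = sinh(t/2) / (t/2)`, which makes `R_{g,n} = (∑ i,
β_i)^{2g-3+n} [t^{2g}] (∏ i, S(β_i t)) / S(t)`. As `S` is even with `S(0) = 1`, setting `β_0 = 0`
in `R_{g,n+1}` multiplies `R_{g,n}` by `∑ i, β_i`, which is the string equation, and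
differentiating in `β_0` at `β_0 = 0` only affects the power of the sum and multiplies `R_{g,n}`
by `2g-2+n`, which is the dilaton equation.

The formula is usually obtained from the characters of the symmetric group on hooks. Characters
are avoided here as follows. For a permutation `s` of `d` points with cycle lengths `β_i`, the
characteristic polynomial of its permutation matrix is `p_s = ∏ i, (X^{β_i} - 1)`
(`permCharpoly_eq_prod`); put `u_s = p_s / (X - 1)`. A transposition changes the permutation
matrix by a matrix of rank one, so the matrix determinant lemma expresses `p_{ts}` through the
adjugate of `X - P_s`. Summing over all transpositions `t` leaves only the trace of the adjugate,
which is the derivative `p_s'`, and the sum of its entries, which is `d u_s`. The outcome is `2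
∑_t u_{ts} = 2 d X u_s' - d (d-1) u_s` (`sum_isSwap_hookPolynomial`): the `j`-th coefficient of
`u_s` is an eigenfunction of multiplication by the sum of all transpositions, with eigenvalue `d
(j - (d-1)/2)`. Since `u_s(1)` is `d` if `s` is a `d`-cycle and `0` otherwise, the number of
factorizations starting from `s` is `d^{r-1}` times the `r`-th moment of the coefficients of `u_s`
about `(d-1)/2` (`card_swap_tuples_mul_card`; transitivity is automatic). The exponential
generating function of these moments is `e^{-(d-1)t/2} u_s(e^t) = (∏ i, 2 sinh(β_i t/2)) / (2
sinh(t/2))` (`mk_hookMoment_div_factorial_eq`). Together with the size `d! / (|Aut β| ∏ i, β_i)`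
of the conjugacy class of `s` this gives the formula.
-/

/-! ### Determinants and sums over transpositions -/

section

open Matrix Polynomial

/-- Jacobi's formula for the characteristic polynomial. -/
theorem derivative_charpoly_eq_trace_adjugate {α R : Type*} [Fintype α] [DecidableEq α]
    [CommRing R] (M : Matrix α α R) :
    derivative M.charpoly = (adjugate M.charmatrix).trace := by
  have key : ∀ i, adjugate M.charmatrix i i = ∑ s : Equiv.Perm α, (Equiv.Perm.sign s : R[X]) *
      ((∏ j ∈ Finset.univ.erase i, M.charmatrix (s j) j) *
        derivative (M.charmatrix (s i) i)) := by
    intro i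
    have h0 : adjugate M.charmatrix i i = (M.charmatrix.updateCol i (Pi.single i 1)).det := by
      rw [← cramer_apply, cramer_eq_adjugate_mulVec, mulVec_single_one]
      rfl
    rw [h0, det_apply']
    refine Finset.sum_congr rfl fun s _ => ?_
    congr 1
    rw [← Finset.prod_erase_mul _ _ (Finset.mem_univ i)]
    congr 1
    · refine Finset.prod_congr rfl fun j hj => ?_
      rw [updateCol_ne (Finset.ne_of_mem_erase hj)]
    · by_cases h : s i = i
      · simp [h, charmatrix_apply_eq]
      · simp [h, charmatrix_apply_ne]
  rw [charpoly, det_apply']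
  simp only [derivative_sum, trace, diag, key]
  rw [Finset.sum_comm]
  refine Finset.sum_congr rfl fun s _ => ?_
  rw [derivative_intCast_mul, derivative_prod_finset, Finset.mul_sum]

/-- The matrix determinant lemma in its adjugate form, which needs no inverse of `A`. It is deduced
from the form with an inverse over the field of fractions. -/
theorem det_add_vecMulVec {α R : Type*} [Fintype α] [DecidableEq α] [CommRing R] [IsDomain R]
    (A : Matrix α α R) (hA : A.det ≠ 0) (u v : α → R) :
    (A + vecMulVec u v).det = A.det + v ⬝ᵥ (adjugate A *ᵥ u) := by
  let f := algebraMap R (FractionRing R)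
  have hf : Function.Injective f := IsFractionRing.injective R (FractionRing R)
  have hd : f A.det ≠ 0 := by rwa [Ne, map_eq_zero_iff f hf]
  apply hf
  have hu : IsUnit (A.map f).det := by
    rw [← RingHom.mapMatrix_apply, ← RingHom.map_det]; exact hd.isUnit
  have h := det_add_replicateCol_mul_replicateRow (ι := Unit) hu (f ∘ u) (f ∘ v)
  have e : (A + vecMulVec u v).map f =
      A.map f + replicateCol Unit (f ∘ u) * replicateRow Unit (f ∘ v) := by
    ext i j
    simp [vecMulVec_apply, Matrix.mul_apply]
  have hdm : (A.map f).det = f A.det := by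
    rw [← RingHom.mapMatrix_apply, ← RingHom.map_det]
  have hadj : adjugate (A.map f) = (adjugate A).map f := by
    rw [← RingHom.mapMatrix_apply, ← RingHom.map_adjugate, RingHom.mapMatrix_apply]
  rw [RingHom.map_det, RingHom.mapMatrix_apply, e, h,
    det_unique (1 + _ : Matrix Unit Unit _), Matrix.add_apply, Matrix.one_apply_eq, hdm,
    Matrix.inv_def, hdm, hadj, Ring.inverse_eq_inv', map_add]
  rw [mul_add, mul_one]
  congr 1
  simp only [Matrix.mul_apply, replicateRow_apply, replicateCol_apply, Matrix.smul_apply, map_apply,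
    dotProduct, mulVec, map_sum, map_mul, Function.comp, smul_eq_mul, Finset.mul_sum,
    Finset.sum_mul]
  rw [Finset.sum_comm]
  refine Finset.sum_congr rfl fun i _ => Finset.sum_congr rfl fun j _ => ?_
  field_simp

open Classical in
/-- Each transposition is `Equiv.swap a b` for exactly two ordered pairs of distinct points. -/
theorem sum_swap_eq {α M : Type*} [Fintype α] [DecidableEq α] [AddCommMonoid M]
    (f : Equiv.Perm α → M) :
    ∑ a, ∑ b ∈ Finset.univ.erase a, f (Equiv.swap a b) =
      2 • ∑ t : Equiv.Perm α with t.IsSwap, f t := by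
  rw [Finset.sum_sigma' Finset.univ (fun a => Finset.univ.erase a)]
  rw [← Finset.sum_fiberwise_of_maps_to (t := Finset.univ.filter Equiv.Perm.IsSwap)
    (g := fun x : Σ _ : α, α => Equiv.swap x.1 x.2)]
  · rw [Finset.smul_sum]
    refine Finset.sum_congr rfl fun t ht => ?_
    obtain ⟨a, b, hab, rfl⟩ := (Finset.mem_filter.1 ht).2
    have : (Finset.univ.sigma fun a : α => Finset.univ.erase a).filter
        (fun x : Σ _ : α, α => Equiv.swap x.1 x.2 = Equiv.swap a b) =
        {(⟨a, b⟩ : Σ _ : α, α), ⟨b, a⟩} := by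
      ext ⟨x, y⟩
      simp only [Finset.mem_filter, Finset.mem_sigma, Finset.mem_univ, Finset.mem_erase, ne_eq,
        true_and, and_true, Finset.mem_insert, Finset.mem_singleton, Sigma.mk.injEq, heq_eq_eq]
      constructor
      · rintro ⟨hxy, h⟩
        have h1 := congrArg (fun s => s x) h
        have h2 := congrArg (fun s => s y) h
        simp only [Equiv.swap_apply_left, Equiv.swap_apply_right, Equiv.swap_apply_def] at h1 h2
        grind
      · rintro (⟨rfl, rfl⟩ | ⟨rfl, rfl⟩)
        · exact ⟨fun h => hab h.symm, rfl⟩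
        · exact ⟨hab, Equiv.swap_comm _ _⟩
    rw [Finset.sum_congr rfl (g := fun _ => f (Equiv.swap a b))
      (fun x hx => by rw [(Finset.mem_filter.1 hx).2]), this, Finset.sum_const,
      Finset.card_pair (by simp [hab])]
  · rintro ⟨a, b⟩ h
    simp only [Finset.mem_sigma, Finset.mem_erase, Finset.mem_univ, and_true, true_and] at h
    simpa using ⟨a, b, fun e => h e.symm, rfl⟩

/-! ### Characteristic polynomials of permutation matrices -/

variable {α : Type*} [Fintype α] [DecidableEq α]

/-- The characteristic polynomial of the permutation matrix of `s`, over `ℚ`. -/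
noncomputable abbrev permCharpoly (s : Equiv.Perm α) : ℚ[X] := (s.permMatrix ℚ).charpoly

/-- A transposition is the reflection in the hyperplane orthogonal to `e_a - e_b`. -/
theorem permMatrix_swap {α : Type*} [DecidableEq α] (a b : α) :
    (Equiv.swap a b).permMatrix ℚ =
      1 - vecMulVec (Pi.single a 1 - Pi.single b 1) (Pi.single a 1 - Pi.single b 1) := by
  ext i j
  simp only [Equiv.Perm.permMatrix, PEquiv.toMatrix_apply, Equiv.toPEquiv_apply, Option.mem_def,
    Option.some.injEq, Matrix.sub_apply, vecMulVec_apply, Pi.sub_apply, Matrix.one_apply,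
    Pi.single_apply, Equiv.swap_apply_def]
  by_cases h1 : i = a <;> by_cases h2 : i = b <;> by_cases h3 : j = a <;> by_cases h4 : j = b <;>
    simp_all [eq_comm]

theorem permCharpoly_swap_mul (s : Equiv.Perm α) {a b : α} (hab : a ≠ b) :
    let B := adjugate (s.permMatrix ℚ).charmatrix
    permCharpoly (Equiv.swap a b * s) =
      X * (B a a + B b b - B a b - B b a) - permCharpoly s := by
  intro B
  set A := (s.permMatrix ℚ).charmatrix with hA
  set v : α → ℚ[X] := Pi.single a 1 - Pi.single b 1 with hv
  have hP : (s.permMatrix ℚ).map (C : ℚ →+* ℚ[X]) = (X : ℚ[X]) • (1 : Matrix α α ℚ[X]) - A := by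
    ext i j
    by_cases h : i = j <;> simp [hA, h]
  have e : ((Equiv.swap a b * s).permMatrix ℚ).charmatrix =
      A + vecMulVec ((s.permMatrix ℚ).map (C : ℚ →+* ℚ[X]) *ᵥ v) v := by
    have h1 : ((Equiv.swap a b).permMatrix ℚ).map (C : ℚ →+* ℚ[X]) = 1 - vecMulVec v v := by
      rw [permMatrix_swap]
      ext i j
      simp only [map_apply, Matrix.sub_apply, vecMulVec_apply, hv, Pi.sub_apply, Pi.single_apply,
        Matrix.one_apply, map_sub, map_mul, apply_ite (C : ℚ →+* ℚ[X]), map_one, map_zero]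
    rw [permMatrix_mul, charmatrix, hA, charmatrix, RingHom.mapMatrix_apply, Matrix.map_mul,
      h1, RingHom.mapMatrix_apply, mul_sub, mul_one, mul_vecMulVec]
    abel
  have hne : A.det ≠ 0 := (charpoly_monic (s.permMatrix ℚ)).ne_zero
  rw [permCharpoly, charpoly, e, det_add_vecMulVec _ hne, hP, mulVec_mulVec, mul_sub,
    adjugate_mul]
  have hd : A.det = permCharpoly s := rfl
  rw [hd]
  simp only [Matrix.mul_smul, Matrix.mul_one, hv, mulVec_sub, sub_dotProduct, dotProduct_sub,
    single_dotProduct, mulVec_single_one, one_mul, Matrix.col_apply, Matrix.sub_apply,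
    Matrix.smul_apply, smul_eq_mul, one_apply_eq, one_apply_ne hab, one_apply_ne hab.symm, B, hA]
  ring

/-- The all-ones vector is an eigenvector of the permutation matrix for the eigenvalue `1`, hence of
the adjugate of `X - P_s`. -/
theorem sum_adjugate_charmatrix_permMatrix (s : Equiv.Perm α) :
    (X - 1 : ℚ[X]) * ∑ i, ∑ j, adjugate (s.permMatrix ℚ).charmatrix i j =
      (Fintype.card α : ℚ[X]) * permCharpoly s := by
  have h1 : (s.permMatrix ℚ).charmatrix *ᵥ 1 = (X - 1 : ℚ[X]) • (1 : α → ℚ[X]) := by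
    rw [charmatrix, sub_mulVec]
    ext i : 1
    have : ((s.permMatrix ℚ).map (C : ℚ →+* ℚ[X]) *ᵥ 1) i = 1 := by
      simp [mulVec, dotProduct, Equiv.Perm.permMatrix, PEquiv.toMatrix_apply, apply_ite]
    rw [RingHom.mapMatrix_apply]
    simp only [Pi.sub_apply, this]
    simp [scalar_apply]
  have h2 := congrArg (fun w => adjugate (s.permMatrix ℚ).charmatrix *ᵥ w) h1
  simp only [mulVec_mulVec, adjugate_mul, mulVec_smul, smul_mulVec, one_mulVec] at h2
  have h3 := congrArg (fun w : α → ℚ[X] => ∑ i, w i) h2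
  simp only [Pi.smul_apply, Pi.one_apply, smul_eq_mul, mul_one, Finset.sum_const,
    Finset.card_univ, nsmul_eq_mul, mulVec, dotProduct] at h3
  rw [Finset.mul_sum]
  exact h3.symm

open Classical in
theorem sum_isSwap_permCharpoly (s : Equiv.Perm α) :
    (2 : ℚ[X]) * ∑ t : Equiv.Perm α with t.IsSwap, permCharpoly (t * s) =
      2 * X * ((Fintype.card α : ℚ[X]) * derivative (permCharpoly s) -
        ∑ i, ∑ j, adjugate (s.permMatrix ℚ).charmatrix i j) -
      (Fintype.card α : ℚ[X]) * ((Fintype.card α : ℚ[X]) - 1) * permCharpoly s := by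
  set B := adjugate (s.permMatrix ℚ).charmatrix with hB
  have h := sum_swap_eq (fun t : Equiv.Perm α => permCharpoly (t * s))
  rw [nsmul_eq_mul] at h
  push_cast at h
  rw [← h, derivative_charpoly_eq_trace_adjugate, ← hB]
  have h1 : ∀ a, ∑ b ∈ Finset.univ.erase a, permCharpoly (Equiv.swap a b * s) =
      ∑ b, (X * (B a a + B b b - B a b - B b a) - permCharpoly s) + permCharpoly s := by
    intro a
    rw [← Finset.sum_erase_add _ _ (Finset.mem_univ a)]
    rw [Finset.sum_congr rfl fun b hb =>
      permCharpoly_swap_mul s (Finset.ne_of_mem_erase hb).symm]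
    ring
  rw [Finset.sum_congr rfl fun a _ => h1 a]
  simp only [Finset.sum_add_distrib, Finset.sum_sub_distrib, ← Finset.mul_sum, Finset.sum_const,
    Finset.card_univ, nsmul_eq_mul, trace, diag]
  rw [Finset.sum_comm (f := fun x i => B i x)]
  ring

theorem permMatrix_apply {α : Type*} [DecidableEq α] (s : Equiv.Perm α) (i j : α) :
    s.permMatrix ℚ i j = if s i = j then 1 else 0 := by
  simp [Equiv.Perm.permMatrix, PEquiv.toMatrix_apply, eq_comm]

theorem permCharpoly_one : permCharpoly (1 : Equiv.Perm α) = (X - 1) ^ Fintype.card α := by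
  rw [permCharpoly, permMatrix_one, charpoly_one]

/-- For disjoint permutations `(1 - P_t) (1 - P_s) = 0`, which is equivalent to
`(X - P_t P_s) (X - 1) = (X - P_t) (X - P_s)`. -/
theorem permCharpoly_mul_of_disjoint {s t : Equiv.Perm α} (h : s.Disjoint t) :
    permCharpoly (s * t) * (X - 1) ^ Fintype.card α = permCharpoly s * permCharpoly t := by
  rw [← permCharpoly_one, permCharpoly, permCharpoly, permCharpoly, permCharpoly, charpoly,
    charpoly, charpoly, charpoly, ← det_mul, mul_comm (s.permMatrix ℚ).charmatrix.det, ← det_mul]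
  congr 1
  have hz : (1 - t.permMatrix ℚ) * (1 - s.permMatrix ℚ) = 0 := by
    ext i j
    have : ∀ k, (1 - t.permMatrix ℚ) i k * (1 - s.permMatrix ℚ) k j = 0 := by
      intro k
      simp only [Matrix.sub_apply, Matrix.one_apply, permMatrix_apply]
      rcases h k with hs | ht
      · simp [hs]
      · by_cases hi : t i = i
        · simp [hi]
        · have h1 : i ≠ k := fun e => hi (e ▸ ht)
          have h2 : t i ≠ k := fun e => hi (t.injective (by rw [e, ht]))
          simp [h1, h2]
    rw [Matrix.mul_apply]
    exact Finset.sum_eq_zero fun k _ => this k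
  have hm : (s * t).permMatrix ℚ = t.permMatrix ℚ + s.permMatrix ℚ - 1 := by
    rw [permMatrix_mul]
    rw [sub_mul, mul_sub, mul_sub, one_mul, one_mul, mul_one] at hz
    rw [← sub_eq_zero, ← hz]
    abel
  have hmul : t.permMatrix ℚ * s.permMatrix ℚ = t.permMatrix ℚ + s.permMatrix ℚ - 1 := by
    rw [← permMatrix_mul, hm]
  have hc : (t.permMatrix ℚ).map (C : ℚ →+* ℚ[X]) * (s.permMatrix ℚ).map (C : ℚ →+* ℚ[X]) =
      (t.permMatrix ℚ).map (C : ℚ →+* ℚ[X]) + (s.permMatrix ℚ).map (C : ℚ →+* ℚ[X]) - 1 := by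
    simp only [← RingHom.mapMatrix_apply]
    rw [← map_mul, hmul, map_sub, map_add, map_one]
  have hX : (scalar α) (X : ℚ[X]) = (X : ℚ[X]) • (1 : Matrix α α ℚ[X]) := by
    ext i j; simp [scalar_apply, Matrix.diagonal, Matrix.one_apply]
  simp only [charmatrix, hm, map_sub, map_add, map_one, permMatrix_one, hX,
    RingHom.mapMatrix_apply]
  simp only [sub_mul, mul_sub, smul_mul_assoc, mul_smul_comm, one_mul, mul_one,
    hc]
  simp only [smul_sub, smul_add]
  abel

/-- In the Leibniz expansion of `det (X - P_s)` a permutation `p` contributes only if every `p i` is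
`i` or `s i`; if `s` is a cycle, this leaves `p = 1` and `p = s`. -/
theorem permCharpoly_isCycle {s : Equiv.Perm α} (h : s.IsCycle) :
    permCharpoly s = (X - 1) ^ (Fintype.card α - s.support.card) * (X ^ s.support.card - 1) := by
  have hcard : ∀ a b : ℚ[X], ∏ i, (if s i = i then a else b) =
      a ^ (Fintype.card α - s.support.card) * b ^ s.support.card := by
    intro a b
    rw [Finset.prod_ite, Finset.prod_const, Finset.prod_const, ← Finset.card_compl]
    congr 3
    · ext; simp
  rw [permCharpoly, charpoly, ← det_transpose, det_apply']
  have hne : (1 : Equiv.Perm α) ≠ s := h.ne_one.symm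
  rw [Finset.sum_eq_add_of_mem (1 : Equiv.Perm α) s (Finset.mem_univ _) (Finset.mem_univ _) hne]
  · have h1 : ∏ i, (s.permMatrix ℚ).charmatrixᵀ ((1 : Equiv.Perm α) i) i =
        ∏ i, if s i = i then (X - 1 : ℚ[X]) else X := by
      refine Finset.prod_congr rfl fun i _ => ?_
      rw [Equiv.Perm.one_apply, transpose_apply, charmatrix_apply_eq, permMatrix_apply]
      split_ifs <;> simp
    have h2 : ∏ i, (s.permMatrix ℚ).charmatrixᵀ (s i) i =
        ∏ i, if s i = i then (X - 1 : ℚ[X]) else -1 := by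
      refine Finset.prod_congr rfl fun i _ => ?_
      rw [transpose_apply, charmatrix_apply, permMatrix_apply, if_pos rfl]
      by_cases hi : s i = i
      · simp [hi]
      · rw [if_neg hi, diagonal_apply_ne _ (Ne.symm hi)]
        simp
    rw [h1, h2, hcard, hcard, h.sign, Equiv.Perm.sign_one]
    have h3 : (-1 : ℚ[X]) ^ s.support.card * (-1) ^ s.support.card = 1 := by
      rw [← mul_pow]; simp
    push_cast
    -- The signs `(-1) ^ (card + 1)` of a cycle and `(-1) ^ card` of its entries combine to `-1`.
    linear_combination (-(X - 1 : ℚ[X]) ^ (Fintype.card α - s.support.card)) * h3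
  · rintro p - ⟨hp1, hps⟩
    by_contra hprod
    have hall : ∀ i, p i = i ∨ p i = s i := by
      intro i
      by_contra hi
      push Not at hi
      refine hprod ?_
      rw [Finset.prod_eq_zero (Finset.mem_univ i), mul_zero]
      rw [transpose_apply, charmatrix_apply_ne _ _ _ (Ne.symm hi.1), permMatrix_apply,
        if_neg (Ne.symm hi.2), map_zero, neg_zero]
    -- If `p` agrees with `s` at one moved point, injectivity of `p` propagates this
    -- along the cycle.
    by_cases hex : ∃ i, s i ≠ i ∧ p i = s i
    · obtain ⟨i, hi, hpi⟩ := hex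
      refine hps (Equiv.ext fun j => ?_)
      by_cases hj : s j = j
      · rcases hall j with e | e
        · rw [e, hj]
        · exact e
      · obtain ⟨k, rfl⟩ := h.exists_pow_eq hi hj
        clear hj
        induction k with
        | zero => simpa using hpi
        | succ k ih =>
          rw [pow_succ', Equiv.Perm.mul_apply]
          rcases hall (s ((s ^ k) i)) with e | e
          · have e2 := p.injective (e.trans ih.symm)
            rw [e2]
            exact ih
          · exact e
    · push Not at hex
      refine hp1 (Equiv.ext fun j => ?_)
      rcases hall j with e | e
      · exact e
      · by_contra hj
        by_cases hs : s j = j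
        · exact hj (by rw [e, hs]; rfl)
        · exact hex j hs e

theorem permCharpoly_eq_cycleType (s : Equiv.Perm α) :
    permCharpoly s = (X - 1) ^ (Fintype.card α - s.support.card) *
      (s.cycleType.map fun b => (X ^ b - 1 : ℚ[X])).prod := by
  induction s using Equiv.Perm.cycle_induction_on with
  | base_one => simp [permCharpoly_one]
  | base_cycles s h => rw [permCharpoly_isCycle h, h.cycleType]; simp
  | induction_disjoint s t hd hs ihs iht =>
    have hX : (X - 1 : ℚ[X]) ≠ 0 := by simpa using X_sub_C_ne_zero (1 : ℚ)
    refine mul_right_cancel₀ (pow_ne_zero (Fintype.card α) hX) ?_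
    rw [permCharpoly_mul_of_disjoint hd, ihs, iht, hd.cycleType_mul, hd.card_support_mul,
      Multiset.map_add, Multiset.prod_add]
    have hle : s.support.card + t.support.card ≤ Fintype.card α := by
      rw [← hd.card_support_mul]; exact Finset.card_le_univ _
    have e : (X - 1 : ℚ[X]) ^ (Fintype.card α - s.support.card) *
        (X - 1) ^ (Fintype.card α - t.support.card) =
        (X - 1) ^ (Fintype.card α - (s.support.card + t.support.card)) *
          (X - 1) ^ Fintype.card α := by
      rw [← pow_add, ← pow_add]
      congr 1
      omega
    linear_combination (s.cycleType.map fun b => (X ^ b - 1 : ℚ[X])).prod *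
      (t.cycleType.map fun b => (X ^ b - 1 : ℚ[X])).prod * e

theorem permCharpoly_eq_prod (s : Equiv.Perm α) :
    permCharpoly s = (s.partition.parts.map fun b => (X ^ b - 1 : ℚ[X])).prod := by
  rw [permCharpoly_eq_cycleType, Equiv.Perm.parts_partition]
  simp [mul_comm]

/-! ### The hook polynomial as a generating function of eigenfunctions -/

theorem isRoot_one_permCharpoly [Nonempty α] (s : Equiv.Perm α) : (permCharpoly s).IsRoot 1 := by
  have h := congrArg (eval 1) (sum_adjugate_charmatrix_permMatrix s)
  simpa [Fintype.card_ne_zero] using h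

/-- The quotient of the characteristic polynomial of the permutation matrix by `X - 1`. It is exact
on nonempty types, and up to sign its coefficients are the characters of the symmetric group
indexed by hooks. -/
noncomputable def hookPolynomial (s : Equiv.Perm α) : ℚ[X] := permCharpoly s /ₘ (X - C 1)

theorem sub_one_mul_hookPolynomial [Nonempty α] (s : Equiv.Perm α) :
    (X - 1 : ℚ[X]) * hookPolynomial s = permCharpoly s := by
  have h := mul_divByMonic_eq_iff_isRoot.2 (isRoot_one_permCharpoly s)
  simpa [hookPolynomial] using h

theorem natDegree_hookPolynomial (s : Equiv.Perm α) :
    (hookPolynomial s).natDegree = Fintype.card α - 1 := by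
  rw [hookPolynomial, natDegree_divByMonic _ (monic_X_sub_C 1), natDegree_X_sub_C,
    charpoly_natDegree_eq_dim]

open Classical in
theorem sum_isSwap_hookPolynomial [Nonempty α] (s : Equiv.Perm α) :
    (2 : ℚ[X]) * ∑ t : Equiv.Perm α with t.IsSwap, hookPolynomial (t * s) =
      2 * (Fintype.card α : ℚ[X]) * (X * derivative (hookPolynomial s)) -
        (Fintype.card α : ℚ[X]) * ((Fintype.card α : ℚ[X]) - 1) * hookPolynomial s := by
  have hX : (X - 1 : ℚ[X]) ≠ 0 := by simpa using X_sub_C_ne_zero (1 : ℚ)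
  have hS : ∑ i, ∑ j, adjugate (s.permMatrix ℚ).charmatrix i j =
      (Fintype.card α : ℚ[X]) * hookPolynomial s := by
    refine mul_left_cancel₀ hX ?_
    rw [sum_adjugate_charmatrix_permMatrix, ← sub_one_mul_hookPolynomial s]
    ring
  have h := sum_isSwap_permCharpoly s
  rw [hS] at h
  simp only [← sub_one_mul_hookPolynomial, ← Finset.mul_sum] at h
  refine mul_left_cancel₀ hX ?_
  rw [derivative_mul, derivative_sub, derivative_X, derivative_one] at h
  linear_combination h

open Classical in
/-- The coefficients of the hook polynomial are eigenfunctions of multiplication by the sum of all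
transpositions. In terms of characters, `j - (d - 1) / 2` times `d` is the content sum of a hook. -/
theorem sum_isSwap_coeff_hookPolynomial [Nonempty α] (s : Equiv.Perm α) (j : ℕ) :
    ∑ t : Equiv.Perm α with t.IsSwap, (hookPolynomial (t * s)).coeff j =
      (Fintype.card α : ℚ) * ((j : ℚ) - ((Fintype.card α : ℚ) - 1) / 2) *
        (hookPolynomial s).coeff j := by
  have h := congrArg (fun p : ℚ[X] => p.coeff j) (sum_isSwap_hookPolynomial s)
  have hd : (X * derivative (hookPolynomial s)).coeff j = j * (hookPolynomial s).coeff j := by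
    cases j with
    | zero => simp
    | succ j => rw [coeff_X_mul, coeff_derivative]; push_cast; ring
  have e1 : (2 : ℚ[X]) = C 2 := (map_ofNat C 2).symm
  have e2 : (Fintype.card α : ℚ[X]) = C (Fintype.card α : ℚ) := by simp
  have e3 : (1 : ℚ[X]) = C 1 := by simp
  simp only [e1, e2, e3, ← C_sub, ← C_mul, mul_assoc, coeff_sub, coeff_C_mul, hd,
    finsetSum_coeff] at h
  linear_combination h / 2

/-- Evaluation at `1` detects full cycles: each cycle beyond the first contributes a factor
`X ^ b - 1`, which vanishes at `1`. -/
theorem eval_one_hookPolynomial [Nonempty α] (s : Equiv.Perm α) :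
    (hookPolynomial s).eval 1 =
      if s.partition.parts = {Fintype.card α} then (Fintype.card α : ℚ) else 0 := by
  have hX : (X - 1 : ℚ[X]) ≠ 0 := by simpa using X_sub_C_ne_zero (1 : ℚ)
  have hsum := s.partition.parts_sum
  obtain ⟨b, m, hm⟩ : ∃ b m, s.partition.parts = b ::ₘ m := by
    refine ⟨_, _, (Multiset.cons_erase (Multiset.exists_mem_of_ne_zero ?_).choose_spec).symm⟩
    intro h
    rw [h] at hsum
    exact Fintype.card_ne_zero (α := α) (by simpa using hsum.symm)
  have hu : hookPolynomial s = (∑ i ∈ Finset.range b, X ^ i) *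
      (m.map fun b => (X ^ b - 1 : ℚ[X])).prod := by
    refine mul_left_cancel₀ hX ?_
    rw [sub_one_mul_hookPolynomial, permCharpoly_eq_prod, hm, Multiset.map_cons,
      Multiset.prod_cons, ← mul_geom_sum]
    ring
  rcases Multiset.empty_or_exists_mem m with rfl | ⟨c, hc⟩
  · rw [hm] at hsum ⊢
    have hb : b = Fintype.card α := by simpa using hsum
    rw [hu, if_pos (by simp [hb])]
    simp [eval_finsetSum, hb]
  · obtain ⟨m', rfl⟩ := Multiset.exists_cons_of_mem hc
    rw [hu, if_neg, Multiset.map_cons, Multiset.prod_cons]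
    · simp
    · rw [hm]
      intro h
      have := congrArg Multiset.card h
      simp at this

end

/-! ### Counting factorizations of a full cycle -/

section

open Polynomial

open Classical in
theorem sum_swap_tuples_of_eigenfunction {α : Type*} [Fintype α] [DecidableEq α]
    {f : Equiv.Perm α → ℚ} {c : ℚ}
    (hf : ∀ s, ∑ t : Equiv.Perm α with t.IsSwap, f (t * s) = c * f s) (r : ℕ) (s : Equiv.Perm α) :
    ∑ τ : Fin r → Equiv.Perm α with ∀ i, (τ i).IsSwap, f ((List.ofFn τ).reverse.prod * s) =
      c ^ r * f s := by
  induction r generalizing s with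
  | zero => simp
  | succ r ih =>
    rw [Finset.sum_filter, ← (Fin.consEquiv fun _ => Equiv.Perm α).sum_comp,
      Fintype.sum_prod_type]
    have h : ∀ (t : Equiv.Perm α) (τ : Fin r → Equiv.Perm α),
        (if ∀ i, ((Fin.consEquiv fun _ => Equiv.Perm α) (t, τ) i).IsSwap then
          f ((List.ofFn ((Fin.consEquiv fun _ => Equiv.Perm α) (t, τ))).reverse.prod * s) else 0) =
        if t.IsSwap then (if ∀ i, (τ i).IsSwap then
          f ((List.ofFn τ).reverse.prod * (t * s)) else 0) else 0 := by
      intro t τ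
      simp [Fin.consEquiv, Fin.forall_fin_succ, List.ofFn_succ, ite_and, mul_assoc]
    simp only [h]
    rw [pow_succ, mul_assoc, ← hf, Finset.mul_sum, Finset.sum_filter]
    refine Finset.sum_congr rfl fun t _ => ?_
    split_ifs with ht
    · rw [← ih, Finset.sum_filter]
    · simp

/-- The `r`-th moment of the coefficients of the hook polynomial about the centre of its degrees. -/
noncomputable def hookMoment {α : Type*} [Fintype α] [DecidableEq α] (r : ℕ) (s : Equiv.Perm α) :
    ℚ :=
  ∑ j ∈ Finset.range (Fintype.card α),
    ((j : ℚ) - ((Fintype.card α : ℚ) - 1) / 2) ^ r * (hookPolynomial s).coeff j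

open Classical in
theorem card_swap_tuples_mul_card {α : Type*} [Fintype α] [DecidableEq α] [Nonempty α] (r : ℕ)
    (s : Equiv.Perm α) :
    (Finset.card {τ : Fin r → Equiv.Perm α | (∀ i, (τ i).IsSwap) ∧
        ((List.ofFn τ).reverse.prod * s).partition.parts = {Fintype.card α}} : ℚ) *
      Fintype.card α = (Fintype.card α : ℚ) ^ r * hookMoment r s := by
  have h1 : (Finset.card {τ : Fin r → Equiv.Perm α | (∀ i, (τ i).IsSwap) ∧
        ((List.ofFn τ).reverse.prod * s).partition.parts = {Fintype.card α}} : ℚ) *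
      Fintype.card α = ∑ τ : Fin r → Equiv.Perm α with ∀ i, (τ i).IsSwap,
        (hookPolynomial ((List.ofFn τ).reverse.prod * s)).eval 1 := by
    simp only [eval_one_hookPolynomial]
    rw [← Finset.sum_filter, Finset.filter_filter, Finset.sum_const, nsmul_eq_mul]
  rw [h1, hookMoment]
  have h2 : ∀ t : Equiv.Perm α, (hookPolynomial t).eval 1 =
      ∑ j ∈ Finset.range (Fintype.card α), (hookPolynomial t).coeff j := by
    intro t
    rw [eval_eq_sum_range' (n := Fintype.card α)]
    · simp
    · rw [natDegree_hookPolynomial]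
      exact Nat.sub_lt Fintype.card_pos one_pos
  simp only [h2]
  rw [Finset.sum_comm, Finset.mul_sum]
  refine Finset.sum_congr rfl fun j _ => ?_
  rw [sum_swap_tuples_of_eigenfunction (f := fun t => (hookPolynomial t).coeff j)
    (fun t => sum_isSwap_coeff_hookPolynomial t j), mul_pow, mul_assoc]

theorem exists_zpow_eq_of_partition_parts_eq_singleton {α : Type*} [Fintype α] [DecidableEq α]
    {s : Equiv.Perm α} (h : s.partition.parts = {Fintype.card α}) (x y : α) :
    ∃ k : ℤ, (s ^ k) x = y := by
  rcases le_or_gt (Fintype.card α) 1 with h1 | h1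
  · have := Fintype.card_le_one_iff_subsingleton.1 h1
    exact ⟨0, Subsingleton.elim _ _⟩
  · have hc : s.cycleType = {Fintype.card α} := by
      rw [← s.filter_parts_partition_eq_cycleType, h, Multiset.filter_singleton,
        if_pos (Nat.succ_le_of_lt h1)]
    have hs : s.support = Finset.univ := by
      rw [← Finset.card_eq_iff_eq_univ, ← Equiv.Perm.sum_cycleType, hc, Multiset.sum_singleton]
    have hcyc : s.IsCycle := Equiv.Perm.card_cycleType_eq_one.1 (by rw [hc]; simp)
    have hx : ∀ z, s z ≠ z := fun z => Equiv.Perm.mem_support.1 (by simp [hs])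
    exact hcyc.exists_zpow_eq (hx x) (hx y)

theorem Nat.Partition.parts_eq_filter_add_replicate {d : ℕ} (p : d.Partition) :
    p.parts = p.parts.filter (2 ≤ ·) +
      Multiset.replicate (d - (p.parts.filter (2 ≤ ·)).sum) 1 := by
  have h1 : p.parts.filter (fun a => ¬ 2 ≤ a) =
      Multiset.replicate (p.parts.filter (fun a => ¬ 2 ≤ a)).card 1 := by
    rw [Multiset.eq_replicate_card]
    intro b hb
    obtain ⟨hb1, hb2⟩ := Multiset.mem_filter.1 hb
    have := p.parts_pos hb1
    omega
  have h2 := Multiset.filter_add_not (2 ≤ ·) p.parts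
  have h3 := congrArg Multiset.sum h2
  rw [Multiset.sum_add, h1, p.parts_sum, Multiset.sum_replicate, smul_eq_mul, mul_one] at h3
  have h4 : d - (p.parts.filter (2 ≤ ·)).sum = (p.parts.filter (fun a => ¬ 2 ≤ a)).card := by
    omega
  rw [h4, ← h1, h2]

/-- Used to reconcile `Equiv.Perm.cycleType`, which omits fixed points, with the parts of a
partition, which count them as parts equal to `1`. -/
theorem prod_factorial_count_add_replicate_one {m : Multiset ℕ} (hm : ∀ a ∈ m, 2 ≤ a) (c : ℕ) :
    ∏ i ∈ (m + Multiset.replicate c 1).toFinset, ((m + Multiset.replicate c 1).count i)! =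
      c ! * ∏ i ∈ m.toFinset, (m.count i)! := by
  have h1 : 1 ∉ m := fun h => absurd (hm 1 h) (by norm_num)
  rw [Finset.prod_subset (s₂ := insert 1 m.toFinset)]
  · rw [Finset.prod_insert (by simpa using h1)]
    congr 1
    · simp [Multiset.count_eq_zero_of_notMem h1]
    · refine Finset.prod_congr rfl fun i hi => ?_
      have : i ≠ 1 := fun e => h1 (by simpa [e] using hi)
      simp [Multiset.count_replicate, this.symm]
  · intro i hi
    simp only [Multiset.mem_toFinset, Multiset.mem_add, Finset.mem_insert] at hi ⊢
    rcases hi with hi | hi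
    · exact Or.inr hi
    · exact Or.inl (Multiset.eq_of_mem_replicate hi)
  · intro i _ hi
    rw [Multiset.mem_toFinset] at hi
    rw [Multiset.count_eq_zero_of_notMem hi, Nat.factorial_zero]

open Classical in
/-- The size of a conjugacy class of permutations. -/
theorem card_partition_parts_eq_mul {d : ℕ} (p : d.Partition) :
    Finset.card {s : Equiv.Perm (Fin d) | s.partition.parts = p.parts} *
      (p.parts.prod * partitionAut p) = d ! := by
  set m := p.parts.filter (2 ≤ ·) with hmdef
  have hm : ∀ a ∈ m, 2 ≤ a := fun a ha => (Multiset.mem_filter.1 ha).2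
  have hp : p.parts = m + Multiset.replicate (d - m.sum) 1 := p.parts_eq_filter_add_replicate
  have hle : m.sum ≤ d := by
    have h := congrArg Multiset.sum hp
    rw [p.parts_sum, Multiset.sum_add] at h
    omega
  have hset : ∀ s : Equiv.Perm (Fin d), s.partition.parts = p.parts ↔ s.cycleType = m := by
    intro s
    constructor
    · intro h
      rw [← s.filter_parts_partition_eq_cycleType, h]
    · intro h
      rw [Equiv.Perm.parts_partition, ← Equiv.Perm.sum_cycleType, h, Fintype.card_fin, ← hp]
  have h := Equiv.Perm.card_of_cycleType_mul_eq (Fin d) m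
  rw [Fintype.card_fin, if_pos ⟨hle, hm⟩] at h
  rw [← h]
  congr 1
  · congr 1
    ext s
    simp [hset]
  · rw [partitionAut, hp, prod_factorial_count_add_replicate_one hm, Multiset.prod_add,
      Multiset.prod_replicate, one_pow]
    ring

/-- In a factorization of a full cycle transitivity is automatic, since the cycle itself lies in
the group generated by the factors. -/
theorem isTransitiveFactorization_indiscrete_iff {d r : ℕ} (hd : d ≠ 0) (β : Nat.Partition d)
    (σ : Equiv.Perm (Fin d)) (τ : Fin r → Equiv.Perm (Fin d)) (γ : Equiv.Perm (Fin d)) :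
    IsTransitiveFactorization (Nat.Partition.indiscrete d) β σ τ γ ↔
      σ.partition.parts = β.parts ∧ ((∀ i, (τ i).IsSwap) ∧
        ((List.ofFn τ).reverse.prod * σ).partition.parts = {d}) ∧
        (List.ofFn τ).reverse.prod * σ = γ := by
  rw [IsTransitiveFactorization, Nat.Partition.indiscrete_parts hd]
  constructor
  · rintro ⟨h1, h2, h3, rfl, -⟩
    exact ⟨h1, ⟨h3, h2⟩, rfl⟩
  · rintro ⟨h1, ⟨h3, h2⟩, rfl⟩
    refine ⟨h1, h2, h3, rfl, ⟨fun x y => ?_⟩⟩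
    obtain ⟨k, hk⟩ := exists_zpow_eq_of_partition_parts_eq_singleton
      (by rw [h2, Fintype.card_fin]) x y
    refine ⟨⟨((List.ofFn τ).reverse.prod * σ) ^ k, Subgroup.zpow_mem _ (Subgroup.mul_mem _
      (Subgroup.list_prod_mem _ fun t ht => ?_) (Subgroup.subset_closure (by simp))) k⟩, hk⟩
    obtain ⟨i, rfl⟩ := (List.mem_ofFn' _ _).1 (List.mem_reverse.1 ht)
    exact Subgroup.subset_closure (Or.inr ⟨i, rfl⟩)

open Classical in
theorem card_isTransitiveFactorization_indiscrete {d r : ℕ} (hd : d ≠ 0) (β : Nat.Partition d) :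
    Nat.card {x : Equiv.Perm (Fin d) × (Fin r → Equiv.Perm (Fin d)) × Equiv.Perm (Fin d) //
        IsTransitiveFactorization (Nat.Partition.indiscrete d) β x.1 x.2.1 x.2.2} =
      ∑ σ : Equiv.Perm (Fin d) with σ.partition.parts = β.parts,
        Finset.card {τ : Fin r → Equiv.Perm (Fin d) | (∀ i, (τ i).IsSwap) ∧
          ((List.ofFn τ).reverse.prod * σ).partition.parts = {d}} := by
  rw [Nat.card_eq_fintype_card, Fintype.card_subtype, Finset.card_filter, Fintype.sum_prod_type,
    Finset.sum_filter]
  refine Finset.sum_congr rfl fun σ _ => ?_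
  rw [Fintype.sum_prod_type]
  simp only [isTransitiveFactorization_indiscrete_iff hd]
  split_ifs with h
  · rw [Finset.card_filter]
    refine Finset.sum_congr rfl fun τ _ => ?_
    simp only [h, true_and, ite_and]
    split_ifs <;> simp
  · simp [h]

/-- The one-part double Hurwitz number in terms of the moments of the hook polynomial. -/
theorem doubleHurwitz_indiscrete_of_hookMoment {g d : ℕ} (hd : d ≠ 0) (β : Nat.Partition d)
    {c : ℚ} (hc : ∀ σ : Equiv.Perm (Fin d), σ.partition.parts = β.parts →
      hookMoment (simpleBranchNumber g 1 β.parts.card) σ = c) :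
    doubleHurwitz g (Nat.Partition.indiscrete d) β * (d * β.parts.prod) =
      (d : ℚ) ^ simpleBranchNumber g 1 β.parts.card * c := by
  classical
  have : Nonempty (Fin d) := ⟨⟨0, Nat.pos_of_ne_zero hd⟩⟩
  have haut : partitionAut (Nat.Partition.indiscrete d) = 1 := by
    simp [partitionAut, Nat.Partition.indiscrete_parts hd]
  have hcard : (Nat.Partition.indiscrete d).parts.card = 1 := by
    simp [Nat.Partition.indiscrete_parts hd]
  rw [doubleHurwitz, card_isTransitiveFactorization_indiscrete hd, haut, hcard]
  have hclass := card_partition_parts_eq_mul β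
  have hsum : ((∑ σ : Equiv.Perm (Fin d) with σ.partition.parts = β.parts,
        Finset.card {τ : Fin (simpleBranchNumber g 1 β.parts.card) → Equiv.Perm (Fin d) |
          (∀ i, (τ i).IsSwap) ∧
          ((List.ofFn τ).reverse.prod * σ).partition.parts = {d}} : ℕ) : ℚ) * d =
      (Finset.card {s : Equiv.Perm (Fin d) | s.partition.parts = β.parts} : ℚ) *
        ((d : ℚ) ^ simpleBranchNumber g 1 β.parts.card * c) := by
    rw [Nat.cast_sum, Finset.sum_mul, ← nsmul_eq_mul, ← Finset.sum_const]
    refine Finset.sum_congr rfl fun σ hσ => ?_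
    have h := card_swap_tuples_mul_card (simpleBranchNumber g 1 β.parts.card) σ
    rw [hc σ (Finset.mem_filter.1 hσ).2] at h
    simpa only [Fintype.card_fin] using h
  have hfac : (d ! : ℚ) ≠ 0 := by exact_mod_cast d.factorial_ne_zero
  have hclass' : (Finset.card {s : Equiv.Perm (Fin d) | s.partition.parts = β.parts} : ℚ) *
      (β.parts.prod * partitionAut β) = d ! := by exact_mod_cast hclass
  rw [Nat.cast_one, one_mul, div_mul_eq_mul_div, div_mul_eq_mul_div, div_eq_iff hfac]
  linear_combination (partitionAut β : ℚ) * β.parts.prod * hsum +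
    (d : ℚ) ^ simpleBranchNumber g 1 β.parts.card * c * hclass'

end

/-! ### Moments of the hook polynomial as power series coefficients -/

section

open Polynomial

/-- The power series `sinh (t / 2) / (t / 2)`. -/
noncomputable def sinhcSeries : PowerSeries ℚ :=
  PowerSeries.mk fun m => if Even m then (1 / 2) ^ m / (m + 1)! else 0

theorem rescale_exp_sub_rescale_exp (a : ℚ) :
    PowerSeries.rescale (a / 2) (PowerSeries.exp ℚ) -
      PowerSeries.rescale (-(a / 2)) (PowerSeries.exp ℚ) =
    PowerSeries.X * (PowerSeries.C a * PowerSeries.rescale a sinhcSeries) := by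
  ext m
  cases m with
  | zero =>
    rw [map_sub, PowerSeries.coeff_rescale, PowerSeries.coeff_rescale]
    simp
  | succ m =>
    rw [PowerSeries.coeff_succ_X_mul, PowerSeries.coeff_C_mul, map_sub, PowerSeries.coeff_rescale,
      PowerSeries.coeff_rescale, PowerSeries.coeff_rescale, PowerSeries.coeff_exp, sinhcSeries,
      PowerSeries.coeff_mk]
    rcases Nat.even_or_odd m with h | h
    · rw [if_pos h, Odd.neg_pow h.add_one, div_pow, one_div_pow]
      simp only [eq_ratCast, Rat.cast_id]
      field_simp
      ring
    · rw [if_neg (Nat.not_even_iff_odd.2 h), Even.neg_pow h.add_one]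
      ring

/-- The identity `e^{bt} - 1 = e^{bt/2} · 2 sinh (b t / 2)`. -/
theorem exp_pow_sub_one (b : ℕ) :
    PowerSeries.exp ℚ ^ b - 1 = PowerSeries.rescale ((b : ℚ) / 2) (PowerSeries.exp ℚ) *
      (PowerSeries.X * (PowerSeries.C (b : ℚ) * PowerSeries.rescale (b : ℚ) sinhcSeries)) := by
  rw [← rescale_exp_sub_rescale_exp, mul_sub, PowerSeries.exp_mul_exp_eq_exp_add,
    PowerSeries.exp_mul_exp_eq_exp_add, add_halves, add_neg_cancel,
    PowerSeries.exp_pow_eq_rescale_exp]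
  simp

theorem constantCoeff_sinhcSeries : PowerSeries.constantCoeff sinhcSeries = 1 := by
  rw [← PowerSeries.coeff_zero_eq_constantCoeff_apply, sinhcSeries, PowerSeries.coeff_mk]
  simp

theorem sinhcSeries_mul_inv : sinhcSeries * sinhcSeries⁻¹ = 1 :=
  PowerSeries.mul_inv_cancel _ (by rw [constantCoeff_sinhcSeries]; exact one_ne_zero)

theorem prod_rescale_exp {ι : Type*} (s : Finset ι) (f : ι → ℚ) :
    ∏ i ∈ s, PowerSeries.rescale (f i) (PowerSeries.exp ℚ) =
      PowerSeries.rescale (∑ i ∈ s, f i) (PowerSeries.exp ℚ) := by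
  classical
  induction s using Finset.induction_on with
  | empty => simp
  | insert a s ha ih =>
    rw [Finset.prod_insert ha, Finset.sum_insert ha, ih, PowerSeries.exp_mul_exp_eq_exp_add]

variable {α : Type*} [Fintype α] [DecidableEq α]

/-- The exponential generating function of the moments is the hook polynomial at `X = e^t`,
recentred by the factor `e^{-(d-1)t/2}`. -/
theorem mk_hookMoment_div_factorial [Nonempty α] (s : Equiv.Perm α) :
    PowerSeries.mk (fun r => hookMoment r s / r !) =
      PowerSeries.rescale (-(((Fintype.card α : ℚ) - 1) / 2)) (PowerSeries.exp ℚ) *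
        aeval (PowerSeries.exp ℚ) (hookPolynomial s) := by
  have hlt : (hookPolynomial s).natDegree < Fintype.card α := by
    rw [natDegree_hookPolynomial]
    exact Nat.sub_lt Fintype.card_pos one_pos
  rw [aeval_eq_sum_range' hlt, Finset.mul_sum]
  ext r
  rw [PowerSeries.coeff_mk, map_sum, hookMoment, Finset.sum_div]
  refine Finset.sum_congr rfl fun j _ => ?_
  rw [mul_smul_comm, PowerSeries.exp_pow_eq_rescale_exp, PowerSeries.exp_mul_exp_eq_exp_add,
    PowerSeries.coeff_smul, PowerSeries.coeff_rescale, PowerSeries.coeff_exp, smul_eq_mul]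
  simp only [eq_ratCast, Rat.cast_id]
  ring

theorem mk_hookMoment_div_factorial_eq [Nonempty α] {n : ℕ} (s : Equiv.Perm α)
    (β : Fin (n + 1) → ℕ) (hβ : s.partition.parts = Finset.univ.val.map β) :
    PowerSeries.mk (fun r => hookMoment r s / r !) =
      PowerSeries.X ^ n * (PowerSeries.C (∏ i, (β i : ℚ)) *
        ((∏ i, PowerSeries.rescale (β i : ℚ) sinhcSeries) * sinhcSeries⁻¹)) := by
  have hsum : ∑ i, (β i : ℚ) = Fintype.card α := by
    have h := s.partition.parts_sum
    rw [hβ] at h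
    exact_mod_cast h
  have hp := congrArg (aeval (PowerSeries.exp ℚ)) (sub_one_mul_hookPolynomial s)
  rw [permCharpoly_eq_prod, hβ, Multiset.map_map] at hp
  change _ = aeval (PowerSeries.exp ℚ) (∏ i, (X ^ β i - 1 : ℚ[X])) at hp
  simp only [map_mul, map_sub, map_one, aeval_X, map_prod, map_pow, exp_pow_sub_one,
    Finset.prod_mul_distrib, prod_rescale_exp, Finset.prod_const, Finset.card_univ,
    Fintype.card_fin, ← Finset.sum_div, hsum] at hp
  have h1 := exp_pow_sub_one 1
  rw [pow_one, Nat.cast_one, map_one, one_mul, PowerSeries.rescale_one, RingHom.id_apply] at h1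
  rw [h1] at hp
  -- Both sides are multiplied by `e^{-dt/2}`, which turns each factor
  -- `e^{bt} - 1` into `2 sinh (b t / 2)`.
  have hE := congrArg (fun F => PowerSeries.rescale (-((Fintype.card α : ℚ) / 2))
    (PowerSeries.exp ℚ) * F) hp
  have e0 : PowerSeries.rescale (-((Fintype.card α : ℚ) / 2)) (PowerSeries.exp ℚ) *
      PowerSeries.rescale ((Fintype.card α : ℚ) / 2) (PowerSeries.exp ℚ) = 1 := by
    rw [PowerSeries.exp_mul_exp_eq_exp_add, neg_add_cancel]
    simp
  have e1 : PowerSeries.rescale (-((Fintype.card α : ℚ) / 2)) (PowerSeries.exp ℚ) *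
      PowerSeries.rescale ((1 : ℚ) / 2) (PowerSeries.exp ℚ) =
      PowerSeries.rescale (-(((Fintype.card α : ℚ) - 1) / 2)) (PowerSeries.exp ℚ) := by
    rw [PowerSeries.exp_mul_exp_eq_exp_add]
    congr 2
    ring
  rw [mk_hookMoment_div_factorial]
  have hX : (PowerSeries.X : PowerSeries ℚ) ≠ 0 := PowerSeries.X_ne_zero
  refine mul_left_cancel₀ hX ?_
  rw [← e1]
  set U := aeval (PowerSeries.exp ℚ) (hookPolynomial s)
  set E := PowerSeries.rescale (-((Fintype.card α : ℚ) / 2)) (PowerSeries.exp ℚ)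
  set G := ∏ i, PowerSeries.rescale (β i : ℚ) sinhcSeries
  have hS := sinhcSeries_mul_inv
  rw [map_prod]
  rw [pow_succ] at hE
  linear_combination sinhcSeries⁻¹ * hE -
    E * PowerSeries.X * PowerSeries.rescale ((1 : ℚ) / 2) (PowerSeries.exp ℚ) * U * hS +
    sinhcSeries⁻¹ * PowerSeries.X ^ n * PowerSeries.X *
      (∏ i, PowerSeries.C (β i : ℚ)) * G * e0

theorem hookMoment_eq [Nonempty α] {n : ℕ} (s : Equiv.Perm α)
    (β : Fin (n + 1) → ℕ) (hβ : s.partition.parts = Finset.univ.val.map β) (N : ℕ) :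
    hookMoment (N + n) s = (N + n)! * ((∏ i, (β i : ℚ)) * PowerSeries.coeff N
      ((∏ i, PowerSeries.rescale (β i : ℚ) sinhcSeries) * sinhcSeries⁻¹)) := by
  have h := congrArg (PowerSeries.coeff (N + n)) (mk_hookMoment_div_factorial_eq s β hβ)
  rw [PowerSeries.coeff_mk, PowerSeries.coeff_X_pow_mul, PowerSeries.coeff_C_mul] at h
  have hf : ((N + n)! : ℚ) ≠ 0 := by exact_mod_cast (N + n).factorial_ne_zero
  rw [← h]
  field_simp

end

/-! ### The one-part Hurwitz quotient in closed form -/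

section

open Polynomial

/-- The power series `sinh (x_i t / 2) / (x_i t / 2)` in `t`, over the polynomials in the `x_i`. -/
noncomputable def scaledSinhcSeries {σ : Type*} (i : σ) : PowerSeries (MvPolynomial σ ℚ) :=
  PowerSeries.mk fun m =>
    MvPolynomial.C (PowerSeries.coeff m sinhcSeries) * MvPolynomial.X i ^ m

/-- The coefficient of `t ^ N` in `(∏ i, S(x_i t)) / S(t)`, where `S(t) = sinh (t / 2) / (t / 2)`,
as a polynomial in the `x_i`. -/
noncomputable def sinhcQuotientCoeff (N n : ℕ) : MvPolynomial (Fin n) ℚ :=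
  PowerSeries.coeff N ((∏ i, scaledSinhcSeries i) *
    PowerSeries.map MvPolynomial.C sinhcSeries⁻¹)

theorem eval_sinhcQuotientCoeff (N n : ℕ) (x : Fin n → ℚ) :
    MvPolynomial.eval x (sinhcQuotientCoeff N n) = PowerSeries.coeff N
      ((∏ i, PowerSeries.rescale (x i) sinhcSeries) * sinhcSeries⁻¹) := by
  have h1 : ∀ i, PowerSeries.map (MvPolynomial.eval x) (scaledSinhcSeries i) =
      PowerSeries.rescale (x i) sinhcSeries := by
    intro i
    ext m
    simp [scaledSinhcSeries, PowerSeries.coeff_rescale, mul_comm]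
  have h2 : PowerSeries.map (MvPolynomial.eval x) (PowerSeries.map MvPolynomial.C sinhcSeries⁻¹) =
      sinhcSeries⁻¹ := by
    ext m
    simp
  rw [sinhcQuotientCoeff, ← PowerSeries.coeff_map, map_mul, map_prod, h2]
  simp only [h1]

/-- The polynomial `(∑ i, x_i) ^ (2g - 3 + n) [t ^ 2g] (∏ i, S(x_i t)) / S(t)`. The exponent does
not truncate when `2g + n ≥ 3`, the only case in which it is used as the one-part Hurwitz quotient. -/
noncomputable def onePartQuotient (g n : ℕ) : MvPolynomial (Fin n) ℚ :=
  (∑ i, MvPolynomial.X i) ^ (2 * g + n - 3) * sinhcQuotientCoeff (2 * g) n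

theorem Nat.Partition.ofSums_parts_of_ne_zero {d : ℕ} {l : Multiset ℕ} (hl : l.sum = d)
    (h : ∀ a ∈ l, a ≠ 0) : (Nat.Partition.ofSums d l hl).parts = l := by
  rw [Nat.Partition.ofSums_parts]
  exact Multiset.filter_eq_self.2 h

/-- The formula of Goulden, Jackson and Vakil for one-part double Hurwitz numbers. -/
theorem isOnePartHurwitzQuotient_onePartQuotient {g n : ℕ} (hn : 0 < n) (h1 : (g, n) ≠ (0, 1))
    (h2 : (g, n) ≠ (0, 2)) : IsOnePartHurwitzQuotient g n (onePartQuotient g n) := by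
  obtain ⟨n, rfl⟩ : ∃ k, n = k + 1 := ⟨n - 1, by omega⟩
  have hgn : 3 ≤ 2 * g + (n + 1) := by
    rcases Nat.eq_zero_or_pos g with rfl | hg
    · simp only [ne_eq, Prod.mk.injEq, true_and] at h1 h2
      omega
    · omega
  intro β hβ
  set d := ∑ i, β i with hd
  have hd0 : d ≠ 0 := by
    have : β 0 ≤ d := Finset.single_le_sum (fun i _ => Nat.zero_le (β i)) (Finset.mem_univ 0)
    have := hβ 0
    omega
  have : Nonempty (Fin d) := ⟨⟨0, Nat.pos_of_ne_zero hd0⟩⟩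
  have hparts : (Nat.Partition.ofSums d (Finset.univ.val.map β) rfl).parts =
      Finset.univ.val.map β := by
    refine Nat.Partition.ofSums_parts_of_ne_zero rfl fun a ha => ?_
    obtain ⟨i, _, rfl⟩ := Multiset.mem_map.1 ha
    exact (hβ i).ne'
  have hcard : (Nat.Partition.ofSums d (Finset.univ.val.map β) rfl).parts.card = n + 1 := by
    rw [hparts]
    simp
  have hr : simpleBranchNumber g 1 (n + 1) = 2 * g + n := by
    rw [simpleBranchNumber]
    omega
  have key := doubleHurwitz_indiscrete_of_hookMoment (g := g) hd0
    (Nat.Partition.ofSums d (Finset.univ.val.map β) rfl) (fun σ hσ => by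
      rw [hcard, hr]
      exact hookMoment_eq σ β (hσ.trans hparts) (2 * g))
  rw [hcard, hr, hparts] at key
  have hprod : (((Finset.univ.val.map β).prod : ℕ) : ℚ) = ∏ i, (β i : ℚ) := by
    change ((∏ i, β i : ℕ) : ℚ) = _
    push_cast
    rfl
  have hd0' : (d : ℚ) ≠ 0 := by exact_mod_cast hd0
  have hb0 : ∏ i, (β i : ℚ) ≠ 0 :=
    Finset.prod_ne_zero_iff.2 fun i _ => by exact_mod_cast (hβ i).ne'
  have hsum : ∑ i, (β i : ℚ) = d := by
    rw [hd]
    push_cast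
    rfl
  rw [hprod] at key
  have hpow : (d : ℚ) ^ (2 * g + n) = d * d * d ^ (2 * g + (n + 1) - 3) := by
    rw [← pow_two, ← pow_add]
    congr 1
    omega
  rw [onePartHurwitz, ← mul_left_inj' (mul_ne_zero hd0' hb0), key, hpow, hr, onePartQuotient]
  simp only [map_mul, map_pow, map_sum, MvPolynomial.eval_X, MvPolynomial.eval_C,
    eval_sinhcQuotientCoeff, hsum]
  ring

/-- A polynomial is determined by its values at tuples of positive integers, and `r! (∑ i, x_i)` is
not a zero divisor. -/
theorem IsOnePartHurwitzQuotient.unique {g n : ℕ} (hn : 0 < n) {P Q : MvPolynomial (Fin n) ℚ}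
    (hP : IsOnePartHurwitzQuotient g n P) (hQ : IsOnePartHurwitzQuotient g n Q) : P = Q := by
  have hf : MvPolynomial.C ((simpleBranchNumber g 1 n)! : ℚ) *
      (∑ i : Fin n, MvPolynomial.X i) ≠ 0 := by
    intro h
    have h' := congrArg (MvPolynomial.eval fun _ => (1 : ℚ)) h
    simp [Nat.factorial_ne_zero, hn.ne'] at h'
  refine mul_left_cancel₀ hf (MvPolynomial.funext_set
    (fun _ : Fin n => (fun m : ℕ => (m : ℚ)) '' Set.Ioi 0) (fun _ => ?_) fun x hx => ?_)
  · exact (Set.Ioi_infinite 0).image Nat.cast_injective.injOn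
  · choose β hβ hx using fun i => hx i (Set.mem_univ i)
    obtain rfl : (fun i => (β i : ℚ)) = x := funext hx
    rw [hP β hβ, hQ β hβ]

theorem onePartHurwitzQuotient_eq {g n : ℕ} (hn : 0 < n) (h1 : (g, n) ≠ (0, 1))
    (h2 : (g, n) ≠ (0, 2)) : onePartHurwitzQuotient g n = onePartQuotient g n := by
  have h := isOnePartHurwitzQuotient_onePartQuotient hn h1 h2
  have hex : ∃ R, IsOnePartHurwitzQuotient g n R := ⟨_, h⟩
  rw [onePartHurwitzQuotient, dif_pos hex]
  exact hex.choose_spec.unique hn h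

/-! ### Low-order coefficients in the first variable -/

theorem coeff_sinhcSeries_zero : PowerSeries.coeff 0 sinhcSeries = 1 := by
  simp [sinhcSeries]

theorem coeff_sinhcSeries_one : PowerSeries.coeff 1 sinhcSeries = 0 := by
  simp [sinhcSeries]

theorem finSuccEquiv_sinhcQuotientCoeff (N n : ℕ) :
    MvPolynomial.finSuccEquiv ℚ n (sinhcQuotientCoeff N (n + 1)) =
      ∑ p ∈ Finset.HasAntidiagonal.antidiagonal N,
        Polynomial.C (MvPolynomial.C (PowerSeries.coeff p.1 sinhcSeries) *
          sinhcQuotientCoeff p.2 n) * Polynomial.X ^ p.1 := by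
  set f : MvPolynomial (Fin (n + 1)) ℚ →+* Polynomial (MvPolynomial (Fin n) ℚ) :=
    RingHomClass.toRingHom (MvPolynomial.finSuccEquiv ℚ n) with hf
  have hC : ∀ a, f (MvPolynomial.C a) = Polynomial.C (MvPolynomial.C a) := fun a =>
    (MvPolynomial.finSuccEquiv ℚ n).commutes a
  have h0 : PowerSeries.map f (scaledSinhcSeries 0) = PowerSeries.mk fun m =>
      Polynomial.C (MvPolynomial.C (PowerSeries.coeff m sinhcSeries)) * Polynomial.X ^ m := by
    ext m : 1
    rw [PowerSeries.coeff_map, scaledSinhcSeries, PowerSeries.coeff_mk, PowerSeries.coeff_mk,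
      map_mul, map_pow, hC]
    congr 2
    exact MvPolynomial.finSuccEquiv_X_zero
  have h1 : ∀ i : Fin n, PowerSeries.map f (scaledSinhcSeries i.succ) =
      PowerSeries.map Polynomial.C (scaledSinhcSeries i) := by
    intro i
    ext m : 1
    rw [PowerSeries.coeff_map, PowerSeries.coeff_map, scaledSinhcSeries, PowerSeries.coeff_mk,
      scaledSinhcSeries, PowerSeries.coeff_mk, map_mul, map_mul, map_pow, map_pow, hC]
    congr 2
    exact MvPolynomial.finSuccEquiv_X_succ
  have h2 : PowerSeries.map f (PowerSeries.map MvPolynomial.C sinhcSeries⁻¹) =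
      PowerSeries.map Polynomial.C (PowerSeries.map MvPolynomial.C sinhcSeries⁻¹) := by
    ext m : 1
    simp only [PowerSeries.coeff_map, hC]
  change f (sinhcQuotientCoeff N (n + 1)) = _
  rw [sinhcQuotientCoeff, ← PowerSeries.coeff_map, map_mul, map_prod, Fin.prod_univ_succ, h0, h2]
  simp only [h1]
  rw [mul_assoc, ← map_prod, ← map_mul, PowerSeries.coeff_mul]
  refine Finset.sum_congr rfl fun p _ => ?_
  rw [PowerSeries.coeff_mk, PowerSeries.coeff_map, sinhcQuotientCoeff, map_mul Polynomial.C]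
  ring

theorem coeff_zero_finSuccEquiv_sinhcQuotientCoeff (N n : ℕ) :
    (MvPolynomial.finSuccEquiv ℚ n (sinhcQuotientCoeff N (n + 1))).coeff 0 =
      sinhcQuotientCoeff N n := by
  rw [finSuccEquiv_sinhcQuotientCoeff, Polynomial.finsetSum_coeff,
    Finset.sum_eq_single_of_mem (0, N) (by simp)]
  · simp [coeff_sinhcSeries_zero]
  · rintro ⟨i, j⟩ hp hne
    rw [Polynomial.coeff_C_mul_X_pow, if_neg]
    rintro rfl
    have hj : 0 + j = N := Finset.HasAntidiagonal.mem_antidiagonal.1 hp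
    exact hne (by rw [← hj, zero_add])

/-- The series `sinh (t / 2) / (t / 2)` is even, so that no term is linear in the first variable. -/
theorem coeff_one_finSuccEquiv_sinhcQuotientCoeff (N n : ℕ) :
    (MvPolynomial.finSuccEquiv ℚ n (sinhcQuotientCoeff N (n + 1))).coeff 1 = 0 := by
  rw [finSuccEquiv_sinhcQuotientCoeff, Polynomial.finsetSum_coeff]
  refine Finset.sum_eq_zero fun p _ => ?_
  rw [Polynomial.coeff_C_mul_X_pow]
  split_ifs with h
  · rw [← h, coeff_sinhcSeries_one]
    simp
  · rfl

theorem finSuccEquiv_onePartQuotient (g n : ℕ) :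
    MvPolynomial.finSuccEquiv ℚ n (onePartQuotient g (n + 1)) =
      (Polynomial.X + Polynomial.C (∑ i, MvPolynomial.X i)) ^ (2 * g + n - 2) *
        MvPolynomial.finSuccEquiv ℚ n (sinhcQuotientCoeff (2 * g) (n + 1)) := by
  rw [onePartQuotient, map_mul, map_pow, map_sum, Fin.sum_univ_succ,
    MvPolynomial.finSuccEquiv_X_zero, map_sum]
  simp only [MvPolynomial.finSuccEquiv_X_succ]
  rfl

theorem coeff_zero_finSuccEquiv_onePartQuotient (g n : ℕ) :
    (MvPolynomial.finSuccEquiv ℚ n (onePartQuotient g (n + 1))).coeff 0 =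
      (∑ i, MvPolynomial.X i) ^ (2 * g + n - 2) * sinhcQuotientCoeff (2 * g) n := by
  rw [finSuccEquiv_onePartQuotient, Polynomial.mul_coeff_zero,
    coeff_zero_finSuccEquiv_sinhcQuotientCoeff, Polynomial.coeff_zero_eq_eval_zero,
    Polynomial.eval_pow, Polynomial.eval_add, Polynomial.eval_X, Polynomial.eval_C, zero_add]

theorem coeff_one_finSuccEquiv_onePartQuotient {g n : ℕ} (h : 3 ≤ 2 * g + n) :
    (MvPolynomial.finSuccEquiv ℚ n (onePartQuotient g (n + 1))).coeff 1 =
      MvPolynomial.C (2 * (g : ℚ) - 2 + n) * onePartQuotient g n := by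
  obtain ⟨e, he⟩ : ∃ e, 2 * g + n = e + 3 := ⟨2 * g + n - 3, by omega⟩
  have he' : (2 * (g : ℚ) - 2 + n) = ((e + 1 : ℕ) : ℚ) := by
    have : (2 * (g : ℚ) + n) = e + 3 := by exact_mod_cast he
    push_cast
    linarith
  rw [finSuccEquiv_onePartQuotient, Polynomial.mul_coeff_one,
    coeff_zero_finSuccEquiv_sinhcQuotientCoeff, coeff_one_finSuccEquiv_sinhcQuotientCoeff,
    mul_zero, zero_add, Polynomial.coeff_X_add_C_pow, onePartQuotient, he', he]
  simp
  ring

end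

/-! ### The string and dilaton equations -/

theorem hurwitzSymbol_eq {g k n : ℕ} {b : Fin n → ℤ} (hn : 0 < n) (h1 : (g, n) ≠ (0, 1))
    (h2 : (g, n) ≠ (0, 2)) (hb : ∑ i, b i + 2 * (k : ℤ) = 4 * (g : ℤ) - 3 + (n : ℤ))
    (h0 : ∀ i, 0 ≤ b i) :
    hurwitzSymbol g k b = (-1) ^ k * MvPolynomial.coeff
      (Finsupp.equivFunOnFinite.symm fun i => (b i).toNat) (onePartQuotient g n) := by
  rw [hurwitzSymbol, if_pos ⟨h1, h2, hb, h0⟩, onePartHurwitzQuotient_eq hn h1 h2]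

theorem equivFunOnFinite_symm_toNat_cons {n : ℕ} (a : ℕ) (b : Fin n → ℤ) :
    (Finsupp.equivFunOnFinite.symm fun i => ((Fin.cons (a : ℤ) b : Fin (n + 1) → ℤ) i).toNat) =
      (Finsupp.equivFunOnFinite.symm fun i => (b i).toNat).cons a := by
  ext i
  refine Fin.cases ?_ (fun j => ?_) i <;> simp

/-- Inserting `τ_a` in front extracts the coefficient of the `a`-th power of the first variable. -/
theorem hurwitzSymbol_cons {g k n : ℕ} {b : Fin n → ℤ} (a : ℕ) (h1 : (g, n) ≠ (0, 0))
    (h2 : (g, n) ≠ (0, 1))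
    (hb : (a : ℤ) + ∑ i, b i + 2 * (k : ℤ) = 4 * (g : ℤ) - 3 + ((n + 1 : ℕ) : ℤ))
    (h0 : ∀ i, 0 ≤ b i) :
    hurwitzSymbol g k (Fin.cons (a : ℤ) b : Fin (n + 1) → ℤ) = (-1) ^ k * MvPolynomial.coeff
      (Finsupp.equivFunOnFinite.symm fun i => (b i).toNat)
      ((MvPolynomial.finSuccEquiv ℚ n (onePartQuotient g (n + 1))).coeff a) := by
  rw [hurwitzSymbol_eq n.succ_pos (by simpa using h1) (by simpa using h2),
    equivFunOnFinite_symm_toNat_cons, ← MvPolynomial.finSuccEquiv_coeff_coeff]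
  · rw [Fin.sum_univ_succ]
    simpa using hb
  · intro i
    refine Fin.cases ?_ (fun j => ?_) i
    · simp
    · simpa using h0 j

theorem hurwitzSymbol_eq_zero {g k n : ℕ} {b : Fin n → ℤ}
    (h : (g, n) = (0, 1) ∨ (g, n) = (0, 2) ∨
      ∑ i, b i + 2 * (k : ℤ) ≠ 4 * (g : ℤ) - 3 + (n : ℤ) ∨ ∃ i, b i < 0) :
    hurwitzSymbol g k b = 0 := by
  rw [hurwitzSymbol, if_neg]
  rintro ⟨h1, h2, h3, h4⟩
  rcases h with h | h | h | ⟨i, hi⟩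
  · exact h1 h
  · exact h2 h
  · exact h h3
  · exact absurd (h4 i) (not_le.2 hi)

theorem hurwitzSymbol_cons_eq_zero {g k n : ℕ} {b : Fin n → ℤ} (a : ℕ)
    (h : (g, n) = (0, 0) ∨ (g, n) = (0, 1) ∨
      (a : ℤ) + ∑ i, b i + 2 * (k : ℤ) ≠ 4 * (g : ℤ) - 3 + ((n + 1 : ℕ) : ℤ) ∨ ∃ i, b i < 0) :
    hurwitzSymbol g k (Fin.cons (a : ℤ) b : Fin (n + 1) → ℤ) = 0 := by
  refine hurwitzSymbol_eq_zero ?_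
  rcases h with h | h | h | ⟨i, hi⟩
  · exact Or.inl (by simpa using h)
  · exact Or.inr (Or.inl (by simpa using h))
  · refine Or.inr (Or.inr (Or.inl ?_))
    rw [Fin.sum_univ_succ]
    simpa using h
  · exact Or.inr (Or.inr (Or.inr ⟨i.succ, by simpa using hi⟩))

theorem coeff_sum_X_mul {n : ℕ} (m : Fin n → ℕ) (P : MvPolynomial (Fin n) ℚ) :
    MvPolynomial.coeff (Finsupp.equivFunOnFinite.symm m) ((∑ i, MvPolynomial.X i) * P) =
      ∑ i, if m i = 0 then 0 else MvPolynomial.coeff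
        (Finsupp.equivFunOnFinite.symm (Function.update m i (m i - 1))) P := by
  rw [Finset.sum_mul, MvPolynomial.coeff_sum]
  refine Finset.sum_congr rfl fun i _ => ?_
  rw [mul_comm, MvPolynomial.coeff_mul_X']
  by_cases h : m i = 0
  · simp [h]
  · rw [if_pos (by simpa using h), if_neg h]
    congr 1
    ext j
    by_cases hj : j = i
    · subst hj
      simp
    · simp [hj]

theorem sum_update_sub_one {n : ℕ} (b : Fin n → ℤ) (i : Fin n) :
    ∑ j, Function.update b i (b i - 1) j = ∑ j, b j - 1 := by
  rw [Finset.sum_update_of_mem (Finset.mem_univ i),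
    ← Finset.add_sum_erase Finset.univ b (Finset.mem_univ i), Finset.sdiff_singleton_eq_erase]
  ring

theorem two_mul_add_of_ne {g n : ℕ} (h1 : (g, n) ≠ (0, 1)) (h2 : (g, n) ≠ (0, 2))
    (hn : 0 < n) : 3 ≤ 2 * g + n := by
  simp only [ne_eq, Prod.mk.injEq] at h1 h2
  omega

theorem hurwitzSymbol_string {g k n : ℕ} {b : Fin n → ℤ} (h1 : ¬ (g = 1 ∧ k = 1 ∧ n = 0))
    (h2 : ¬ (g = 0 ∧ k = 0 ∧ n = 2 ∧ b = 0)) :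
    hurwitzSymbol g k (Fin.cons 0 b : Fin (n + 1) → ℤ) =
      ∑ i : Fin n, hurwitzSymbol g k (Function.update b i (b i - 1)) := by
  rw [show (0 : ℤ) = ((0 : ℕ) : ℤ) by simp]
  by_cases hb : ∑ i, b i + 2 * (k : ℤ) = 4 * (g : ℤ) - 3 + ((n + 1 : ℕ) : ℤ)
  swap
  · rw [hurwitzSymbol_cons_eq_zero, Finset.sum_eq_zero]
    · refine fun i _ => hurwitzSymbol_eq_zero (Or.inr (Or.inr (Or.inl ?_)))
      rw [sum_update_sub_one]
      push_cast at hb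
      omega
    · exact Or.inr (Or.inr (Or.inl (by push_cast at hb ⊢; omega)))
  by_cases h0 : ∀ i, 0 ≤ b i
  swap
  · push Not at h0
    obtain ⟨j, hj⟩ := h0
    rw [hurwitzSymbol_cons_eq_zero _ (Or.inr (Or.inr (Or.inr ⟨j, hj⟩))), Finset.sum_eq_zero]
    refine fun i _ => hurwitzSymbol_eq_zero (Or.inr (Or.inr (Or.inr ⟨j, ?_⟩)))
    rcases eq_or_ne j i with rfl | hij
    · rw [Function.update_self]
      omega
    · rwa [Function.update_of_ne hij]
  have hb' : ((0 : ℕ) : ℤ) + ∑ i, b i + 2 * (k : ℤ) = 4 * (g : ℤ) - 3 + ((n + 1 : ℕ) : ℤ) := by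
    rw [← hb]
    simp
  have hsum : 0 ≤ ∑ i, b i := Finset.sum_nonneg fun i _ => h0 i
  rcases Nat.eq_zero_or_pos n with rfl | hn
  -- The symbol is `±` the constant coefficient of `R_{g,1}`, which is divisible by `β ^ (2g - 2)`.
  · have hg : 2 ≤ g := by
      simp at hb
      omega
    have e : ∀ m, (g, 0) ≠ (0, m) := by
      rintro m h
      simp only [Prod.mk.injEq] at h
      omega
    rw [hurwitzSymbol_cons 0 (e 0) (e 1) hb' h0, coeff_zero_finSuccEquiv_onePartQuotient]
    simp [show 2 * g - 2 ≠ 0 by omega]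
  rcases eq_or_ne (g, n) (0, 1) with hgn | hgn1
  · rw [hurwitzSymbol_cons_eq_zero _ (Or.inr (Or.inl hgn)), Finset.sum_eq_zero]
    exact fun i _ => hurwitzSymbol_eq_zero (Or.inl hgn)
  -- Here the degree condition reads `∑ i, b i + 2 * k = 0`, which is the excluded exceptional case.
  have hgn2 : (g, n) ≠ (0, 2) := by
    intro h
    obtain ⟨rfl, rfl⟩ := Prod.mk.inj h
    push_cast at hb
    refine h2 ⟨rfl, by omega, rfl, funext fun i => ?_⟩
    exact (Finset.sum_eq_zero_iff_of_nonneg fun i _ => h0 i).1 (by omega) i (Finset.mem_univ i)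
  have hgn0 : (g, n) ≠ (0, 0) := by
    intro h
    exact hn.ne' (Prod.mk.inj h).2
  have h3 := two_mul_add_of_ne hgn1 hgn2 hn
  rw [hurwitzSymbol_cons 0 hgn0 hgn1 hb' h0, coeff_zero_finSuccEquiv_onePartQuotient,
    show 2 * g + n - 2 = (2 * g + n - 3) + 1 by omega, pow_succ', mul_assoc, coeff_sum_X_mul,
    Finset.mul_sum]
  refine Finset.sum_congr rfl fun i _ => ?_
  rcases eq_or_ne (b i) 0 with hi | hi
  · rw [if_pos (by simp [hi]), mul_zero, hurwitzSymbol_eq_zero]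
    exact Or.inr (Or.inr (Or.inr ⟨i, by simp [hi]⟩))
  · have hpos := h0 i
    rw [if_neg (by omega), hurwitzSymbol_eq hn hgn1 hgn2]
    · congr 3
      ext j
      rcases eq_or_ne j i with rfl | hij
      · simp
      · simp [hij]
    · rw [sum_update_sub_one]
      push_cast at hb
      omega
    · intro j
      rcases eq_or_ne j i with rfl | hij
      · rw [Function.update_self]
        omega
      · rw [Function.update_of_ne hij]
        exact h0 j

theorem hurwitzSymbol_dilaton (g k : ℕ) {n : ℕ} (b : Fin n → ℤ) :
    hurwitzSymbol g k (Fin.cons 1 b : Fin (n + 1) → ℤ) =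
      (2 * (g : ℚ) - 2 + (n : ℚ)) * hurwitzSymbol g k b := by
  rw [show (1 : ℤ) = ((1 : ℕ) : ℤ) by simp]
  by_cases hb : ∑ i, b i + 2 * (k : ℤ) = 4 * (g : ℤ) - 3 + (n : ℤ)
  swap
  · rw [hurwitzSymbol_cons_eq_zero, hurwitzSymbol_eq_zero (Or.inr (Or.inr (Or.inl hb))), mul_zero]
    exact Or.inr (Or.inr (Or.inl (by push_cast; omega)))
  by_cases h0 : ∀ i, 0 ≤ b i
  swap
  · push Not at h0
    rw [hurwitzSymbol_cons_eq_zero _ (Or.inr (Or.inr (Or.inr h0))),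
      hurwitzSymbol_eq_zero (Or.inr (Or.inr (Or.inr h0))), mul_zero]
  have hn : 0 < n := by
    rcases Nat.eq_zero_or_pos n with rfl | hn
    · simp at hb
      omega
    · exact hn
  have hsum : 0 ≤ ∑ i, b i := Finset.sum_nonneg fun i _ => h0 i
  -- The degree condition with `0 ≤ ∑ i, b i` already excludes the unstable cases.
  have h3 : 3 ≤ 2 * g + n := by omega
  have e : ∀ m, m ≤ 2 → (g, n) ≠ (0, m) := by
    rintro m hm h
    simp only [Prod.mk.injEq] at h
    omega
  rw [hurwitzSymbol_cons _ (e 0 (by norm_num)) (e 1 (by norm_num)) (by push_cast; omega) h0,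
    hurwitzSymbol_eq hn (e 1 (by norm_num)) (e 2 le_rfl) hb h0,
    coeff_one_finSuccEquiv_onePartQuotient h3, MvPolynomial.coeff_C_mul]
  ring

/-! ### Exceptional values -/

theorem coeff_two_inv_sinhcSeries : PowerSeries.coeff 2 sinhcSeries⁻¹ = -1 / 24 := by
  have h : ∀ m, PowerSeries.coeff m (sinhcSeries * sinhcSeries⁻¹) =
      PowerSeries.coeff m (1 : PowerSeries ℚ) := fun m => by rw [sinhcSeries_mul_inv]
  have e0 := h 0
  have e2 := h 2
  have hs2 : PowerSeries.coeff 2 sinhcSeries = 1 / 24 := by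
    rw [sinhcSeries, PowerSeries.coeff_mk, if_pos (by decide)]
    norm_num [Nat.factorial]
  simp only [PowerSeries.coeff_mul, Finset.Nat.antidiagonal_succ, Finset.Nat.antidiagonal_zero,
    Finset.map_singleton, Finset.sum_cons, Finset.sum_singleton, Finset.map_cons,
    Function.Embedding.prodMap, PowerSeries.coeff_one] at e0 e2
  simp [coeff_sinhcSeries_zero, coeff_sinhcSeries_one, hs2, constantCoeff_sinhcSeries] at e0 e2
  linarith

theorem sinhcQuotientCoeff_zero_right (N : ℕ) :
    sinhcQuotientCoeff N 0 = MvPolynomial.C (PowerSeries.coeff N sinhcSeries⁻¹) := by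
  rw [sinhcQuotientCoeff]
  simp

theorem constantCoeff_sinhcQuotientCoeff_zero (n : ℕ) :
    MvPolynomial.constantCoeff (sinhcQuotientCoeff 0 n) = 1 := by
  rw [← MvPolynomial.eval_zero, eval_sinhcQuotientCoeff]
  simp [constantCoeff_sinhcSeries]

theorem hurwitzSymbol_one_one : hurwitzSymbol 1 1 ![0] = 1 / 24 := by
  have h := hurwitzSymbol_cons (g := 1) (k := 1) (b := (![] : Fin 0 → ℤ)) 0 (by simp) (by simp)
    (by simp) (by simp)
  rw [coeff_zero_finSuccEquiv_onePartQuotient, sinhcQuotientCoeff_zero_right,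
    coeff_two_inv_sinhcSeries] at h
  have e : (Fin.cons ((0 : ℕ) : ℤ) ![] : Fin 1 → ℤ) = ![0] := by
    ext i
    fin_cases i
    rfl
  have e' : (Finsupp.equivFunOnFinite.symm fun i => ((![] : Fin 0 → ℤ) i).toNat) =
      (0 : Fin 0 →₀ ℕ) := Subsingleton.elim _ _
  rw [← e, h, e', mul_one, Nat.add_zero, Nat.sub_self, pow_zero, one_mul,
    MvPolynomial.coeff_zero_C]
  norm_num

theorem hurwitzSymbol_zero_zero : hurwitzSymbol 0 0 ![0, 0, 0] = 1 := by
  rw [hurwitzSymbol_eq (by norm_num) (by simp) (by simp) (by simp [Fin.sum_univ_succ])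
    (by intro i; fin_cases i <;> simp), onePartQuotient]
  have e : (Finsupp.equivFunOnFinite.symm fun i => ((![0, 0, 0] : Fin 3 → ℤ) i).toNat) = 0 := by
    ext i
    fin_cases i <;> rfl
  rw [e, ← MvPolynomial.constantCoeff_eq]
  simp [constantCoeff_sinhcQuotientCoeff_zero]

theorem proposition3p5 :
    (∀ g n : ℕ, 0 < n → (g, n) ≠ (0, 1) → (g, n) ≠ (0, 2) →
      ∃! R : MvPolynomial (Fin n) ℚ, IsOnePartHurwitzQuotient g n R) ∧
    (∀ (g k n : ℕ) (b : Fin n → ℤ),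
      ¬ (g = 1 ∧ k = 1 ∧ n = 0) → ¬ (g = 0 ∧ k = 0 ∧ n = 2 ∧ b = 0) →
      hurwitzSymbol g k (Fin.cons 0 b : Fin (n + 1) → ℤ) =
        ∑ i : Fin n, hurwitzSymbol g k (Function.update b i (b i - 1))) ∧
    hurwitzSymbol 1 1 ![0] = 1 / 24 ∧
    hurwitzSymbol 0 0 ![0, 0, 0] = 1 ∧
    (∀ (g k n : ℕ) (b : Fin n → ℤ),
      hurwitzSymbol g k (Fin.cons 1 b : Fin (n + 1) → ℤ) =
        (2 * (g : ℚ) - 2 + (n : ℚ)) * hurwitzSymbol g k b) :=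
  ⟨fun _ _ hn h1 h2 => ⟨_, isOnePartHurwitzQuotient_onePartQuotient hn h1 h2,
      fun _ hR => hR.unique hn (isOnePartHurwitzQuotient_onePartQuotient hn h1 h2)⟩,
    fun _ _ _ _ h1 h2 => hurwitzSymbol_string h1 h2, hurwitzSymbol_one_one,
    hurwitzSymbol_zero_zero, fun g k _ b => hurwitzSymbol_dilaton g k b⟩
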